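/- Let \(X\) be a non-empty Tychonoff (\(T_{3.5}\): completely regular and \(T_0\)) space, let \(C_p(X)\) be the set of continuous functions \(X\to\mathbb R\) with the topology of pointwise convergence, and let \(\mathbf 0\in C_p(X)\) be the zero function. Notation. An \(\omega\)-cover of a space \(Y\) is an open cover \(\mathcal U\) of \(Y\) such that every finite \(F\subseteq Y\) is contained in some \(U\in\mathcal U\); \(\Omega_Y\) is the set of all \(\omega\)-covers of \(Y\). For \(y\in Y\), \(\Omega_{Y,y}=\{A\subseteq Y: y\in\overline A\}\), and \(\mathcal D_Y\) is the set of dense subsets of \(Y\). For collections \(\mathcal A,\mathcal B\) of sets, \(S_1(\mathcal A,\mathcal B)\) says that for all \(A_n\in\mathcal A\) \((n<\omega)\) there are \(b_n\in A_n\) with \(\{b_n:n<\omega\}\in\mathcal B\); in the game \(G_1(\mathcal A,\mathcal B)\), in each round \(n<\omega\) player I plays \(A_n\in\mathcal A\) and player II answers with \(b_n\in A_n\), and II wins iff \(\{b_n:n<\omega\}\in\mathcal B\). - In \(\Omega FO(X)\), I plays finite sets \(F_n\subseteq X\), II plays open sets \(U_n\supseteq F_n\), and I wins iff \(\{U_n:n<\omega\}\)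 is an \(\omega\)-cover of \(X\). - In the clustering game of \(Y\) at \(y\), I plays open sets \(U_n\ni y\), II plays points \(y_n\in U_n\), and I wins iff \(y\) is a cluster point of the sequence \((y_n)_{n<\omega}\) (every neighbourhood of \(y\) contains \(y_n\) for infinitely many \(n\)). - In the closure game \(CL(Y,y)\), I plays non-empty open sets \(U_n\subseteq Y\), II plays points \(y_n\in U_n\), and I wins iff \(y\in\overline{\{y_n:n<\omega\}}\). - The discrete selection game \(CD(Y)\) is played like \(CL(Y,y)\), but II wins iff \(\{y_n:n<\omega\}\) is closed and discrete in \(Y\). "Wins" means: has a winning strategy using all earlier moves of the opponent. "II Markov-wins" means: II has a winning strategy that depends only on I's most recent move and the round number. "I pre-wins" means: I has a winning strategy that depends only on the round number. A space \(Y\) is \(\Omega\)-Rothberger if \(S_1(\Omega_Y,\Omega_Y)\) holds; it has strong countable fan tightness if \(S_1(\Omega_{Y,y},\Omega_{Y,y})\) holds for every \(y\in Y\), and strong countable dense fan tightness if \(S_1(\mathcal D_Y,\Omega_{Y,y})\) holds for every \(y\in Y\). Theorem. The following are equivalent (in (d), (f) and (h), both listed forms are equivalent to all the other conditions). (a) II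 wins \(\Omega FO(X)\). (b) II Markov-wins \(\Omega FO(X)\). (c) I wins \(G_1(\Omega_X,\Omega_X)\). (d) \(X\) is not \(\Omega\)-Rothberger; that is, I pre-wins \(G_1(\Omega_X,\Omega_X)\). (e) I wins \(G_1(\Omega_{C_p(X),\mathbf 0},\Omega_{C_p(X),\mathbf 0})\). (f) \(C_p(X)\) does not have strong countable fan tightness; that is, I pre-wins \(G_1(\Omega_{C_p(X),\mathbf 0},\Omega_{C_p(X),\mathbf 0})\). (g) I wins \(G_1(\mathcal D_{C_p(X)},\Omega_{C_p(X),\mathbf 0})\). (h) \(C_p(X)\) does not have strong countable dense fan tightness; that is, I pre-wins \(G_1(\mathcal D_{C_p(X)},\Omega_{C_p(X),\mathbf 0})\). (i) II wins the clustering game of \(C_p(X)\) at \(\mathbf 0\). (j) II Markov-wins the clustering game of \(C_p(X)\) at \(\mathbf 0\). (k) II wins \(CL(C_p(X),\mathbf 0)\). (l) II Markov-wins \(CL(C_p(X),\mathbf 0)\). (m) II wins \(CD(C_p(X))\). (n) II Markov-wins \(CD(C_p(X))\). -/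

import Mathlib

open Set Filter Topology

/-- A two-player game of length `ω`: in each round player I chooses a move in `A`, and player II
answers with a move in `B`. `legalI a` says that I may play `a`, `legalII a b` says that `b` is
an admissible answer to `a`, and `winI a b` says that I wins the play in which I has chosen
`a 0, a 1, …` and II has chosen `b 0, b 1, …`. II wins every play that I does not win. -/
structure OmegaGame (A B : Type*) where
  legalI : A → Prop
  legalII : A → B → Prop
  winI : (ℕ → A) → (ℕ → B) → Prop

namespace OmegaGame

variable {A B : Type*}

/-- The list `[f 0, …, f (n - 1)]` of the first `n` terms of a sequence. -/
def initial {M : Type*} (f : ℕ → M) (n : ℕ) : List M := (List.range n).map f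

/-- I has a winning (perfect information) strategy `σ`: in round `n` the move is
`σ [b 0, …, b (n - 1)]`, where the `b i` are II's earlier moves. -/
def IWins (G : OmegaGame A B) : Prop :=
  ∃ σ : List B → A, (∀ s, G.legalI (σ s)) ∧
    ∀ b : ℕ → B, (∀ n, G.legalII (σ (initial b n)) (b n)) →
      G.winI (fun n => σ (initial b n)) b

/-- I has a winning predetermined strategy: the move depends on the number of the round only. -/
def IPredeterminedWins (G : OmegaGame A B) : Prop :=
  ∃ σ : ℕ → A, (∀ n, G.legalI (σ n)) ∧
    ∀ b : ℕ → B, (∀ n, G.legalII (σ n) (b n)) → G.winI σ b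

/-- II has a winning (perfect information) strategy `σ`: in round `n` the move is
`σ [a 0, …, a n]`, where the `a i` are I's moves so far. -/
def IIWins (G : OmegaGame A B) : Prop :=
  ∃ σ : List A → B,
    (∀ (s : List A) (a : A), (∀ c ∈ s, G.legalI c) → G.legalI a → G.legalII a (σ (s ++ [a]))) ∧
    ∀ a : ℕ → A, (∀ n, G.legalI (a n)) → ¬ G.winI a (fun n => σ (initial a (n + 1)))

/-- II has a winning Markov strategy: the move depends only on I's most recent move and on the
number of the round. -/
def IIMarkovWins (G : OmegaGame A B) : Prop :=
  ∃ σ : A → ℕ → B, (∀ a n, G.legalI a → G.legalII a (σ a n)) ∧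
    ∀ a : ℕ → A, (∀ n, G.legalI (a n)) → ¬ G.winI a (fun n => σ (a n) n)

end OmegaGame

/-- The selection principle `S₁(𝒜, ℬ)`: from every sequence of members of `𝒜` one can select
one element each so that the selected elements form a member of `ℬ`. -/
def StrongSelection {M : Type*} (𝒜 ℬ : Set (Set M)) : Prop :=
  ∀ a : ℕ → Set M, (∀ n, a n ∈ 𝒜) → ∃ b : ℕ → M, (∀ n, b n ∈ a n) ∧ range b ∈ ℬ

/-- The selection game `G₁(𝒜, ℬ)`: I plays members of `𝒜`, II plays elements of them, and II
wins if the chosen elements form a member of `ℬ`. -/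
def strongSelectionGame {M : Type*} (𝒜 ℬ : Set (Set M)) : OmegaGame (Set M) M where
  legalI a := a ∈ 𝒜
  legalII a b := b ∈ a
  winI _ b := range b ∉ ℬ

section Space

variable (X : Type*) [TopologicalSpace X]

/-- The collection `Ω_X` of all `ω`-covers of `X`: the open covers such that every finite subset
of `X` is contained in a member of the cover. -/
def omegaCovers : Set (Set (Set X)) :=
  {𝒰 | (∀ U ∈ 𝒰, IsOpen U) ∧ ⋃₀ 𝒰 = univ ∧ ∀ F : Set X, F.Finite → ∃ U ∈ 𝒰, F ⊆ U}

/-- The collection `𝒟_X` of all dense subsets of `X`. -/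
def denseSets : Set (Set X) := {D | Dense D}

variable {X} in
/-- The collection `Ω_{X,x}` of all subsets of `X` that have `x` in their closure. -/
def blades (x : X) : Set (Set X) := {A | x ∈ closure A}

/-- `X` is `Ω`-Rothberger: `S₁(Ω_X, Ω_X)` holds. -/
def OmegaRothberger : Prop := StrongSelection (omegaCovers X) (omegaCovers X)

/-- Strong countable fan tightness: `S₁(Ω_{X,x}, Ω_{X,x})` holds at every point `x`. -/
def StrongCountableFanTightness : Prop :=
  ∀ x : X, StrongSelection (blades x) (blades x)

/-- Strong countable dense fan tightness: `S₁(𝒟_X, Ω_{X,x})` holds at every point `x`. -/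
def StrongCountableDenseFanTightness : Prop :=
  ∀ x : X, StrongSelection (denseSets X) (blades x)

/-- The game `ΩFO(X)`: I plays finite subsets of `X`, II plays open sets that contain them, and I
wins if II's sets form an `ω`-cover of `X`. -/
def omegaFiniteOpenGame : OmegaGame (Set X) (Set X) where
  legalI F := F.Finite
  legalII F U := IsOpen U ∧ F ⊆ U
  winI _ U := range U ∈ omegaCovers X

variable {X} in
/-- Gruenhage's clustering game at `x`: I plays open neighbourhoods of `x`, II plays points of
them, and I wins if `x` is a cluster point of the sequence of II's points. -/
def clusteringGame (x : X) : OmegaGame (Set X) X where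
  legalI U := IsOpen U ∧ x ∈ U
  legalII U y := y ∈ U
  winI _ y := MapClusterPt x atTop y

variable {X} in
/-- The closure game `CL(X, x)`: I plays non-empty open sets, II plays points of them, and I wins
if `x` is in the closure of the set of II's points. -/
def closureGame (x : X) : OmegaGame (Set X) X where
  legalI U := IsOpen U ∧ U.Nonempty
  legalII U y := y ∈ U
  winI _ y := x ∈ closure (range y)

/-- The discrete selection game `CD(X)`: I plays non-empty open sets, II plays points of them, and
II wins if the set of II's points is closed and discrete. -/
def discreteSelectionGame : OmegaGame (Set X) X where
  legalI U := IsOpen U ∧ U.Nonempty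
  legalII U y := y ∈ U
  winI _ y := ¬ (IsClosed (range y) ∧ IsDiscrete (range y))

/-- `C_p(X)`: the continuous real-valued functions on `X` with the topology of pointwise
convergence, that is, the subspace topology inherited from the product `X → ℝ`. -/
abbrev Cp : Type _ := {f : X → ℝ // Continuous f}

/-- The zero function, as a point of `C_p(X)`. -/
def Cp.zeroFun : Cp X := ⟨fun _ => 0, continuous_const⟩

end Space

/-! Everything turns on the failure of `OmegaRothberger X`. A sequence of ω-covers witnessing it
gives II a Markov strategy in the finite-open game: answer a finite set in round n by a member of
the n-th cover containing it. Conversely, a winning strategy of II lets I win the selection game by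
offering all answers that II could give. The circle is closed by Pawlikowski's theorem
(`RothbergerSpace.exists_play`), applied to the finite subsets of `X` with the upper Vietoris
topology. Its proof takes a Hurewicz-type bound f that confines play to finitely many histories per
round, while each point infinitely often finds all its answers below f; one Rothberger selection
then treats all these histories at once.

To reach C_p(X), an ω-cover is turned into the dense set of functions equal to 1 off some member. In
the other direction, a set with 0 in its closure offers the sets {|f| < 1/(n+1)} in round n;
capturing each finite set infinitely often makes 0 a cluster point. For CD, II's n-th function
equals n off the n-th open set, so if these sets are no ω-cover, some finite set sees values tending
to infinity. -/

/-- Rothberger's property `S₁(𝒪, 𝒪)`, for indexed open covers that may depend on the round. -/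
def RothbergerSpace (P : Type*) [TopologicalSpace P] : Prop :=
  ∀ 𝒱 : ℕ → Set (Set P), (∀ n, ∀ V ∈ 𝒱 n, IsOpen V) → (∀ n x, ∃ V ∈ 𝒱 n, x ∈ V) →
    ∃ v : ℕ → Set P, (∀ n, v n ∈ 𝒱 n) ∧ ∀ x, ∃ n, x ∈ v n

/-! ### Selections and diagonal bounds in Rothberger spaces -/

namespace RothbergerSpace

variable {P : Type*} [TopologicalSpace P]

theorem exists_select (hP : RothbergerSpace P) {ι : ℕ → Type*} (V : ∀ n, ι n → Set P)
    (hV : ∀ n i, IsOpen (V n i)) (hc : ∀ n x, ∃ i, x ∈ V n i) :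
    ∃ i : ∀ n, ι n, ∀ x, ∃ n, x ∈ V n (i n) := by
  obtain ⟨v, hv, hx⟩ := hP (fun n => range (V n)) (by rintro n _ ⟨i, rfl⟩; exact hV n i)
    (fun n x => by obtain ⟨i, hi⟩ := hc n x; exact ⟨_, ⟨i, rfl⟩, hi⟩)
  choose i hi using hv
  exact ⟨i, fun x => by obtain ⟨n, hn⟩ := hx x; exact ⟨n, by rwa [hi n]⟩⟩

/-- Split the rounds into infinitely many infinite blocks by `Nat.pair` and select a cover from each
block. -/
theorem exists_select_frequently (hP : RothbergerSpace P) {ι : ℕ → Type*}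
    (V : ∀ n, ι n → Set P) (hV : ∀ n i, IsOpen (V n i)) (hc : ∀ n x, ∃ i, x ∈ V n i) :
    ∃ i : ∀ n, ι n, ∀ x, ∃ᶠ n in atTop, x ∈ V n (i n) := by
  have h (m : ℕ) := hP.exists_select (fun k => V (Nat.pair m k)) (fun _ => hV _) fun _ => hc _
  choose j hj using h
  have key : ∀ n, ∃ i : ι n, ∀ m k, (e : Nat.pair m k = n) → i = e ▸ j m k := by
    intro n
    obtain ⟨m, k, rfl⟩ : ∃ m k, Nat.pair m k = n := ⟨_, _, Nat.pair_unpair n⟩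
    refine ⟨j m k, fun m' k' e => ?_⟩
    obtain ⟨rfl, rfl⟩ := Nat.pair_eq_pair.1 e
    rfl
  choose i hi using key
  refine ⟨i, fun x => frequently_atTop.2 fun m => ?_⟩
  obtain ⟨k, hk⟩ := hj m x
  exact ⟨Nat.pair m k, Nat.left_le_pair m k, by rw [hi _ m k rfl]; exact hk⟩

/-- Functions to `ℕ` with open sublevel sets can be bounded pointwise in some coordinate. -/
theorem exists_le (hP : RothbergerSpace P) (φ : ℕ → P → ℕ)
    (hφ : ∀ n x, ∀ᶠ y in 𝓝 x, φ n y ≤ φ n x) : ∃ f : ℕ → ℕ, ∀ x, ∃ n, φ n x ≤ f n := by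
  refine hP.exists_select (fun n k => {x | φ n x ≤ k}) (fun n k => ?_) fun n x => ⟨φ n x, le_refl (φ n x)⟩
  exact isOpen_iff_mem_nhds.2 fun x (hx : _ ≤ _) => (hφ n x).mono fun y hy => hy.trans hx

theorem countable_cover (hP : RothbergerSpace P) {ι : Type*} (V : ι → Set P)
    (hV : ∀ i, IsOpen (V i)) (hc : ∀ x, ∃ i, x ∈ V i) :
    ∃ i : ℕ → ι, ∀ x, ∃ n, x ∈ V (i n) :=
  hP.exists_select (fun _ => V) (fun _ => hV) fun _ => hc

/-- Iterates of `c ↦ max c (g n c x)` from round `m` and value `j` on. -/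
def iterBound (g : ℕ → ℕ → P → ℕ) (m j : ℕ) (x : P) : ℕ → ℕ
  | 0 => j
  | k + 1 => max (iterBound g m j x k) (g (m + k) (iterBound g m j x k) x)

theorem eventually_iterBound_le {g : ℕ → ℕ → P → ℕ} (hmono : ∀ n x, Monotone fun c => g n c x)
    (hg : ∀ n c x, ∀ᶠ y in 𝓝 x, g n c y ≤ g n c x) (m j : ℕ) (x : P) (k : ℕ) :
    ∀ᶠ y in 𝓝 x, iterBound g m j y k ≤ iterBound g m j x k := by
  induction k with
  | zero => exact Eventually.of_forall fun _ => le_rfl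
  | succ k ih =>
    filter_upwards [ih, hg (m + k) (iterBound g m j x k) x] with y h1 h2
    exact max_le_max h1 ((hmono _ _ h1).trans h2)

/-- Hurewicz' theorem on the Menger game, in the form of a diagonal bound: `g n c x` is the bound
which the point `x` needs in round `n` if the bound of the previous round was `c`. -/
theorem exists_monotone_frequently_le (hP : RothbergerSpace P) (g : ℕ → ℕ → P → ℕ)
    (hmono : ∀ n x, Monotone fun c => g n c x)
    (hg : ∀ n c x, ∀ᶠ y in 𝓝 x, g n c y ≤ g n c x) :
    ∃ f : ℕ → ℕ, Monotone f ∧ ∀ x, ∃ᶠ n in atTop, g n (f n) x ≤ f (n + 1) := by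
  -- The offset `j + 1` makes the round `m + k + j + 1` exceed `m`, `j` and `k`, so that `f` there
  -- already dominates `F m j k`.
  have h (m j : ℕ) := hP.exists_le (fun k x => iterBound g m j x (k + j + 1))
    fun k x => eventually_iterBound_le hmono hg m j x _
  choose F hF using h
  let B : ℕ → Finset (ℕ × ℕ × ℕ) := fun n =>
    Finset.range n ×ˢ Finset.range n ×ˢ Finset.range n
  let f : ℕ → ℕ := fun n => (B n).sup fun q => F q.1 q.2.1 q.2.2
  have hf : Monotone f := fun a b hab =>
    Finset.sup_mono (Finset.product_subset_product (Finset.range_mono hab)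
      (Finset.product_subset_product (Finset.range_mono hab) (Finset.range_mono hab)))
  have hFf (m j k : ℕ) : F m j k ≤ f (m + k + j + 1) :=
    Finset.le_sup (f := fun q : ℕ × ℕ × ℕ => F q.1 q.2.1 q.2.2) (b := (m, j, k))
      (Finset.mem_product.2 ⟨Finset.mem_range.2 (by dsimp only; omega),
        Finset.mem_product.2 ⟨Finset.mem_range.2 (by dsimp only; omega),
          Finset.mem_range.2 (by dsimp only; omega)⟩⟩)
  refine ⟨f, hf, fun x => frequently_atTop.2 fun m => ?_⟩
  -- If `x` fails from round `m` on, the iterates started at `f m` stay above `f`; but `F m (f m)`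
  -- bounds one of them, and `f` dominates that bound in the same round.
  by_contra! hlt
  have hle (k : ℕ) : f (m + k) ≤ iterBound g m (f m) x k := by
    induction k with
    | zero => exact le_rfl
    | succ k ih =>
      exact (hlt (m + k) (by omega)).le.trans ((hmono _ _ ih).trans (le_max_right _ _))
  obtain ⟨k, hk⟩ := hF m (f m) x
  have h1 := hlt (m + (k + f m)) (by omega)
  have h2 : g (m + (k + f m)) (f (m + (k + f m))) x ≤ iterBound g m (f m) x (k + f m + 1) :=
    (hmono _ _ (hle _)).trans (le_max_right _ _)
  have h3 := hFf m (f m) k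
  have e : m + (k + f m) + 1 = m + k + f m + 1 := by omega
  rw [e] at h1
  omega

end RothbergerSpace

/-! ### Finite histories and recursively defined plays -/

/-- The lists of length `n` with entries at most `c`. -/
def boundedLists (n c : ℕ) : Set (List ℕ) := {s | s.length = n ∧ ∀ a ∈ s, a ≤ c}

theorem finite_boundedLists (n c : ℕ) : (boundedLists n c).Finite := by
  induction n with
  | zero => exact (finite_singleton []).subset fun s hs => List.length_eq_zero_iff.1 hs.1
  | succ n ih =>
    refine ((finite_Iic c).image2 List.cons ih).subset fun s hs => ?_
    cases s with
    | nil => exact absurd hs.1 (by simp)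
    | cons a s =>
      exact ⟨a, hs.2 a (by simp), s, ⟨by simpa using hs.1,
        fun b hb => hs.2 b (by simp [hb])⟩, rfl⟩

theorem OmegaGame.initial_succ {M : Type*} (f : ℕ → M) (n : ℕ) :
    OmegaGame.initial f (n + 1) = OmegaGame.initial f n ++ [f n] := by
  simp [OmegaGame.initial, List.range_succ]

theorem OmegaGame.exists_eq_initial {M : Type*} (φ : ℕ → List M → M) :
    ∃ f : ℕ → M, ∀ n, f n = φ n (OmegaGame.initial f n) := by
  let H : ℕ → List M := fun n => n.rec [] fun n h => h ++ [φ n h]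
  have hH (n : ℕ) : H n = OmegaGame.initial (fun n => φ n (H n)) n := by
    induction n with
    | zero => rfl
    | succ n ih => rw [OmegaGame.initial_succ, ← ih]
  exact ⟨fun n => φ n (H n), fun n => congrArg (φ n) (hH n)⟩

/-! ### Pawlikowski's theorem -/

namespace RothbergerSpace

variable {P : Type*} [TopologicalSpace P]

open OmegaGame (initial)

/-- If every point is in a union `⋃ i, W n i` for infinitely many `n`, then one set of each of
these families can be chosen so that every point is in infinitely many chosen sets. -/
theorem exists_select_of_frequently (hP : RothbergerSpace P) {ι : Type*} [Nonempty ι]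
    (W : ℕ → ι → Set P) (hW : ∀ n i, IsOpen (W n i))
    (hc : ∀ x, ∃ᶠ n in atTop, ∃ i, x ∈ W n i) :
    ∃ i : ℕ → ι, ∀ x, ∃ᶠ n in atTop, x ∈ W n (i n) := by
  classical
  -- Which rounds are good depends on the point, so the k-th selection guesses k + 1 rounds together
  -- with the choices for them.
  obtain ⟨t, ht⟩ := hP.exists_select_frequently
    (ι := fun k => {T : Finset ℕ // T.card = k + 1} × (ℕ → ι))
    (fun k t => ⋂ n ∈ t.1.1, W n (t.2 n))
    (fun k t => isOpen_biInter_finset fun n _ => hW _ _) (by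
      intro k x
      obtain ⟨T, hT, hk⟩ := (Nat.frequently_atTop_iff_infinite.1 (hc x)).exists_subset_card_eq (k + 1)
      have : ∀ n, ∃ i, n ∈ T → x ∈ W n i := fun n => by
        by_cases hn : n ∈ T
        · obtain ⟨i, hi⟩ := hT hn
          exact ⟨i, fun _ => hi⟩
        · exact ⟨Classical.arbitrary ι, fun h => absurd h hn⟩
      choose i hi using this
      exact ⟨(⟨T, hk⟩, i), mem_iInter₂.2 fun n hn => hi n hn⟩)
  -- Hall's theorem assigns to each guess a round of its own; the largest index in a finite set of
  -- guesses alone supplies enough rounds.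
  obtain ⟨N, hN, hNt⟩ := (Finset.all_card_le_biUnion_card_iff_exists_injective
    fun k => (t k).1.1).1 (by
      intro s
      rcases s.eq_empty_or_nonempty with rfl | hs
      · simp
      · calc s.card ≤ (Finset.range (s.max' hs + 1)).card :=
              Finset.card_le_card fun a ha => Finset.mem_range.2 (by
                have := s.le_max' a ha; omega)
          _ = (t (s.max' hs)).1.1.card := by rw [(t _).1.2, Finset.card_range]
          _ ≤ _ := Finset.card_le_card
              (Finset.subset_biUnion_of_mem (fun k => (t k).1.1) (s.max'_mem hs)))
  refine ⟨fun n => (t (Function.invFun N n)).2 n, fun x => ?_⟩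
  have hinf := (Nat.frequently_atTop_iff_infinite.1 (ht x)).image hN.injOn
  refine Nat.frequently_atTop_iff_infinite.2 (hinf.mono ?_)
  rintro _ ⟨k, hk, rfl⟩
  change x ∈ W (N k) ((t (Function.invFun N (N k))).2 (N k))
  rw [Function.leftInverse_invFun hN k]
  exact mem_iInter₂.1 hk _ (hNt k)

/-- Pawlikowski's theorem for a tree of countable open covers: in a Rothberger space some branch
covers every point infinitely often. -/
theorem exists_branch (hP : RothbergerSpace P) (U : List ℕ → ℕ → Set P)
    (hU : ∀ s a, IsOpen (U s a)) (hc : ∀ s x, ∃ a, x ∈ U s a) :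
    ∃ p : ℕ → ℕ, ∀ x, ∃ᶠ n in atTop, x ∈ U (initial p n) (p n) := by
  classical
  let u : List ℕ → P → ℕ := fun s x => Nat.find (hc s x)
  have hu (s : List ℕ) (x : P) : x ∈ U s (u s x) := Nat.find_spec (hc s x)
  let L : ℕ → ℕ → Finset (List ℕ) := fun n c => (finite_boundedLists (n + 1) c).toFinset
  have hL {n c s} : s ∈ L n c ↔ s.length = n + 1 ∧ ∀ a ∈ s, a ≤ c :=
    Finite.mem_toFinset _
  obtain ⟨f, hf, hfg⟩ := hP.exists_monotone_frequently_le
    (fun n c x => (L n c).sup fun s => u s x)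
    (fun n x c d hcd => Finset.sup_mono fun s hs =>
      hL.2 ⟨(hL.1 hs).1, fun a ha => ((hL.1 hs).2 a ha).trans hcd⟩)
    (fun n c x => by
      have : ∀ᶠ y in 𝓝 x, ∀ s ∈ L n c, u s y ≤ u s x :=
        (Filter.eventually_all_finset _).2 fun s _ =>
          ((hU _ _).eventually_mem (hu s x)).mono fun y hy => Nat.find_min' _ hy
      exact this.mono fun y hy => Finset.sup_mono_fun hy)
  obtain ⟨i, hi⟩ := hP.exists_select_of_frequently (ι := List ℕ → ℕ)
    -- One choice serves all bounded histories at once; the `min` keeps the next move below `f (n +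
    -- 1)`, so that the branch never leaves the bounded lists.
    (fun n i => ⋂ s ∈ L n (f n), U s (min (i s) (f (n + 1))))
    (fun n i => isOpen_biInter_finset fun s _ => hU _ _)
    (fun x => (hfg x).mono fun n hn => ⟨fun s => u s x, mem_iInter₂.2 fun s hs => by
      rw [min_eq_left ((Finset.le_sup (f := fun s => u s x) hs).trans hn)]
      exact hu s x⟩)
  obtain ⟨p, hp⟩ := OmegaGame.exists_eq_initial
    -- The choice `i n` concerns histories of length `n + 1`, hence the shift; move 0 is arbitrary.
    fun n s => if n = 0 then 0 else min (i (n - 1) s) (f n)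
  have hpf (n : ℕ) : p n ≤ f n := by
    rw [hp]
    split_ifs
    · exact Nat.zero_le _
    · exact min_le_right _ _
  refine ⟨p, fun x => ?_⟩
  have : ∃ᶠ n in atTop, x ∈ U (initial p (n + 1)) (p (n + 1)) := (hi x).mono fun n hn => by
    rw [hp (n + 1)]
    refine mem_iInter₂.1 hn _ (hL.2 ⟨by simp [initial], fun a ha => ?_⟩)
    obtain ⟨k, hk, rfl⟩ := List.mem_map.1 ha
    exact (hpf k).trans (hf (Nat.lt_succ_iff.1 (List.mem_range.1 hk)))
  exact (tendsto_add_atTop_nat 1).frequently this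

/-- Pawlikowski's theorem: player I has no winning strategy in the Rothberger game. Here the
strategy lets I offer the moves in `R s`, where `s` lists II's earlier moves, and the move `m`
stands for the open set `O s m`. -/
theorem exists_play (hP : RothbergerSpace P) {M : Type*} [Nonempty P] (R : List M → Set M)
    (O : List M → M → Set P) (hO : ∀ s m, IsOpen (O s m)) (hc : ∀ s x, ∃ m ∈ R s, x ∈ O s m) :
    ∃ b : ℕ → M, (∀ n, b n ∈ R (initial b n)) ∧
      ∀ x, ∃ᶠ n in atTop, x ∈ O (initial b n) (b n) := by
  -- The Rothberger property yields countable subcovers, so I's strategy becomes a tree indexed by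
  -- lists of naturals.
  have h (s : List M) := hP.countable_cover (fun m : R s => O s m) (fun m => hO s m)
    fun x => by obtain ⟨m, hm, hx⟩ := hc s x; exact ⟨⟨m, hm⟩, hx⟩
  choose e he using h
  let hist : List ℕ → List M := List.foldl (fun h a => h ++ [(e h a : M)]) []
  obtain ⟨p, hp⟩ := hP.exists_branch (fun s a => O (hist s) (e (hist s) a))
    (fun _ _ => hO _ _) fun s x => he _ x
  let b : ℕ → M := fun n => e (hist (initial p n)) (p n)
  have hb (n : ℕ) : hist (initial p n) = initial b n := by
    induction n with
    | zero => rfl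
    | succ n ih =>
      rw [OmegaGame.initial_succ, OmegaGame.initial_succ, ← ih]
      simp only [hist, List.foldl_append, List.foldl_cons, List.foldl_nil, b]
  refine ⟨b, fun n => ?_, fun x => (hp x).mono fun n hn => ?_⟩
  · rw [← hb]
    exact (e (hist (initial p n)) (p n)).2
  · rwa [← hb]

end RothbergerSpace

/-! ### Transfer of strategies -/

namespace OmegaGame

variable {A B : Type*}

/-- The moves of I can be recovered from answers given according to a strategy `τ` of II. -/
theorem exists_recover (legal : A → Prop) (τ : List A → B) :
    ∃ ρ : List B → List A, (∀ h, ∀ c ∈ ρ h, legal c) ∧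
      ∀ b : ℕ → B, (∀ n, ∃ a, legal a ∧ τ (ρ (initial b n) ++ [a]) = b n) →
        ∃ a : ℕ → A, (∀ n, legal (a n)) ∧ ∀ n, τ (initial a (n + 1)) = b n := by
  classical
  -- Any legal move producing the given answer will do: the recovered play need only have the same
  -- answers. The list is kept if no such move exists.
  let step : List A → B → List A := fun s b =>
    if h : ∃ a, legal a ∧ τ (s ++ [a]) = b then s ++ [h.choose] else s
  refine ⟨List.foldl step [], fun h => ?_, fun b hb => ?_⟩
  · induction h using List.reverseRecOn with
    | nil => simp
    | append_singleton h b ih =>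
      rw [List.foldl_append, List.foldl_cons, List.foldl_nil]
      simp only [step]
      split_ifs with hex
      · intro c hc
        rcases List.mem_append.1 hc with hc | hc
        · exact ih c hc
        · rw [List.mem_singleton.1 hc]
          exact hex.choose_spec.1
      · exact ih
  · let a : ℕ → A := fun n => (hb n).choose
    have ha (n : ℕ) : List.foldl step [] (initial b n) = initial a n := by
      induction n with
      | zero => rfl
      | succ n ih =>
        rw [initial_succ, initial_succ, List.foldl_append, List.foldl_cons, List.foldl_nil,
          ← ih]
        simp only [step]
        rw [dif_pos (hb n)]
    refine ⟨a, fun n => (hb n).choose_spec.1, fun n => ?_⟩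
    rw [initial_succ, ← ha]
    exact (hb n).choose_spec.2

theorem IIMarkovWins.iiWins {G : OmegaGame A B} [Nonempty B] (h : G.IIMarkovWins) : G.IIWins := by
  obtain ⟨σ, hσ, hw⟩ := h
  -- The list includes I's current move, so the round is its length minus one; the default is used
  -- only for the empty list.
  refine ⟨fun s => (s.getLast?.map fun a => σ a (s.length - 1)).getD (Classical.arbitrary B),
    fun s a _ ha => ?_, fun a ha => ?_⟩
  · simpa using hσ a _ ha
  · convert hw a ha using 2 with n
    ext n
    rw [initial_succ]
    simp [initial]

theorem IPredeterminedWins.iWins {G : OmegaGame A B} (h : G.IPredeterminedWins) : G.IWins := by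
  obtain ⟨σ, hσ, hw⟩ := h
  have e (b : ℕ → B) (n : ℕ) : (initial b n).length = n := by simp [initial]
  refine ⟨fun s => σ s.length, fun s => hσ _, fun b hb => ?_⟩
  simp only [e] at hb ⊢
  exact hw b hb

end OmegaGame

theorem not_strongSelection_iff {M : Type*} {𝒜 ℬ : Set (Set M)} :
    ¬ StrongSelection 𝒜 ℬ ↔ (strongSelectionGame 𝒜 ℬ).IPredeterminedWins := by
  unfold StrongSelection OmegaGame.IPredeterminedWins strongSelectionGame
  push Not
  rfl

theorem iWins_strongSelectionGame_mono {M : Type*} {𝒜 𝒜' ℬ : Set (Set M)} (h : 𝒜 ⊆ 𝒜')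
    (hw : (strongSelectionGame 𝒜 ℬ).IWins) : (strongSelectionGame 𝒜' ℬ).IWins :=
  let ⟨σ, hσ, hw⟩ := hw
  ⟨σ, fun s => h (hσ s), hw⟩

theorem StrongSelection.mono {M : Type*} {𝒜 𝒜' ℬ : Set (Set M)} (h : 𝒜 ⊆ 𝒜')
    (hs : StrongSelection 𝒜' ℬ) : StrongSelection 𝒜 ℬ :=
  fun a ha => hs a fun n => h (ha n)

/-- Used with the translations of C_p(X), to reduce tightness at every point to tightness at 0. -/
theorem StrongSelection.of_equiv {M : Type*} {𝒜 𝒜' ℬ ℬ' : Set (Set M)} (φ : M ≃ M)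
    (h𝒜 : ∀ a ∈ 𝒜', φ '' a ∈ 𝒜) (hℬ : ∀ b ∈ ℬ, φ.symm '' b ∈ ℬ') (h : StrongSelection 𝒜 ℬ) :
    StrongSelection 𝒜' ℬ' := by
  intro a ha
  obtain ⟨b, hb, hr⟩ := h (fun n => φ '' a n) fun n => h𝒜 _ (ha n)
  refine ⟨fun n => φ.symm (b n), fun n => ?_, ?_⟩
  · obtain ⟨m, hm, e⟩ := hb n
    simpa [← e] using hm
  · have := hℬ _ hr
    rwa [← range_comp] at this

theorem denseSets_subset_blades {Y : Type*} [TopologicalSpace Y] (y : Y) :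
    denseSets Y ⊆ blades y := fun _ hD => hD y

/-! ### ω-covers and the finite-open game -/

section OmegaCovers

variable {X : Type*} [TopologicalSpace X]

theorem mem_omegaCovers_iff {𝒰 : Set (Set X)} :
    𝒰 ∈ omegaCovers X ↔ (∀ U ∈ 𝒰, IsOpen U) ∧ ∀ F : Set X, F.Finite → ∃ U ∈ 𝒰, F ⊆ U := by
  refine ⟨fun h => ⟨h.1, h.2.2⟩, fun h => ⟨h.1, eq_univ_of_forall fun x => ?_, h.2⟩⟩
  obtain ⟨U, hU, hx⟩ := h.2 {x} (finite_singleton x)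
  exact ⟨U, hU, hx rfl⟩

variable (X) in
/-- The upper Vietoris topology on the finite subsets of `X`. -/
abbrev finsetUpperTopology : TopologicalSpace (Finset X) where
  IsOpen S := ∀ F ∈ S, ∃ U : Set X, IsOpen U ∧ ↑F ⊆ U ∧ ∀ G : Finset X, ↑G ⊆ U → G ∈ S
  isOpen_univ _ _ := ⟨univ, isOpen_univ, subset_univ _, fun _ _ => trivial⟩
  isOpen_inter S T hS hT F hF := by
    obtain ⟨U, hU, hFU, hUS⟩ := hS F hF.1
    obtain ⟨V, hV, hFV, hVT⟩ := hT F hF.2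
    exact ⟨U ∩ V, hU.inter hV, subset_inter hFU hFV, fun G hG =>
      ⟨hUS G (hG.trans inter_subset_left), hVT G (hG.trans inter_subset_right)⟩⟩
  isOpen_sUnion 𝒮 h𝒮 F := by
    rintro ⟨S, hS, hF⟩
    obtain ⟨U, hU, hFU, hUS⟩ := h𝒮 S hS F hF
    exact ⟨U, hU, hFU, fun G hG => ⟨S, hS, hUS G hG⟩⟩

/-- An open cover of the finite sets induces an ω-cover of `X`: the open sets all of whose finite
subsets lie in a single member. -/
theorem OmegaRothberger.rothbergerSpace_finset (h : OmegaRothberger X) :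
    @RothbergerSpace (Finset X) (finsetUpperTopology X) := by
  intro 𝒱 hV hc
  obtain ⟨U, hU, hr⟩ := h
    (fun n => {U | IsOpen U ∧ ∃ V ∈ 𝒱 n, ∀ G : Finset X, ↑G ⊆ U → G ∈ V})
    fun n => mem_omegaCovers_iff.2 ⟨fun U hU => hU.1, fun F hF => by
      obtain ⟨V, hVn, hFV⟩ := hc n hF.toFinset
      obtain ⟨U, hU, hFU, hUV⟩ := hV n V hVn _ hFV
      exact ⟨U, ⟨hU, V, hVn, hUV⟩, by simpa using hFU⟩⟩
  choose hUo V hVn hUV using hU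
  refine ⟨V, hVn, fun F => ?_⟩
  obtain ⟨_, ⟨n, rfl⟩, hn⟩ := (mem_omegaCovers_iff.1 hr).2 F F.finite_toSet
  exact ⟨n, hUV n F hn⟩

/-- In an `Ω`-Rothberger space every strategy of I in a game of selecting from `ω`-covers can be
beaten, even so that every finite set is captured infinitely often. -/
theorem OmegaRothberger.exists_play (h : OmegaRothberger X) {M : Type*} (R : List M → Set M)
    (O : List M → M → Set X) (hO : ∀ s m, IsOpen (O s m))
    (hc : ∀ s (F : Finset X), ∃ m ∈ R s, ↑F ⊆ O s m) :
    ∃ b : ℕ → M, (∀ n, b n ∈ R (OmegaGame.initial b n)) ∧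
      ∀ F : Finset X, ∃ᶠ n in atTop, ↑F ⊆ O (OmegaGame.initial b n) (b n) := by
  let := finsetUpperTopology X
  exact h.rothbergerSpace_finset.exists_play R (fun s m => {F : Finset X | (F : Set X) ⊆ O s m})
    (fun s m F hF => ⟨O s m, hO s m, hF, fun G hG => hG⟩) hc

theorem not_omegaRothberger_of_iWins
    (h : (strongSelectionGame (omegaCovers X) (omegaCovers X)).IWins) : ¬ OmegaRothberger X := by
  intro hR
  obtain ⟨σ, hσ, hw⟩ := h
  -- `interior` makes every conceivable move open; it changes nothing for members of an ω-cover.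
  obtain ⟨b, hb, hF⟩ := hR.exists_play σ (fun _ U => interior U) (fun _ _ => isOpen_interior)
    fun s F => by
      obtain ⟨U, hU, hFU⟩ := (mem_omegaCovers_iff.1 (hσ s)).2 F F.finite_toSet
      exact ⟨U, hU, by rwa [((hσ s).1 U hU).interior_eq]⟩
  refine hw b hb (mem_omegaCovers_iff.2 ⟨?_, fun F hf => ?_⟩)
  · rintro _ ⟨n, rfl⟩
    exact (hσ _).1 _ (hb n)
  · obtain ⟨n, hn⟩ := (hF hf.toFinset).exists
    exact ⟨_, ⟨n, rfl⟩, by simpa using hn.trans interior_subset⟩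

/-- I offers all answers of II to finite sets at the current position; II's selections then trace
out a play of the finite-open game. -/
theorem iWins_omegaCovers_of_iiWins (h : (omegaFiniteOpenGame X).IIWins) :
    (strongSelectionGame (omegaCovers X) (omegaCovers X)).IWins := by
  obtain ⟨τ, hτ, hw⟩ := h
  obtain ⟨ρ, hρ, hrec⟩ := OmegaGame.exists_recover Set.Finite τ
  refine ⟨fun h => {U | ∃ F, F.Finite ∧ τ (ρ h ++ [F]) = U}, fun h => ?_, fun b hb => ?_⟩
  · refine mem_omegaCovers_iff.2 ⟨?_, fun F hF => ?_⟩
    · rintro _ ⟨F, hF, rfl⟩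
      exact (hτ _ F (hρ h) hF).1
    · exact ⟨_, ⟨F, hF, rfl⟩, (hτ _ F (hρ h) hF).2⟩
  · obtain ⟨F, hF, e⟩ := hrec b hb
    have := hw F hF
    simp only [e] at this
    exact this

theorem iiMarkovWins_of_iPredeterminedWins_omegaCovers
    (h : (strongSelectionGame (omegaCovers X) (omegaCovers X)).IPredeterminedWins) :
    (omegaFiniteOpenGame X).IIMarkovWins := by
  obtain ⟨σ, hσ, hw⟩ := h
  have (F : Set X) (n : ℕ) : ∃ U, F.Finite → U ∈ σ n ∧ F ⊆ U := by
    by_cases hF : F.Finite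
    · obtain ⟨U, hU⟩ := (mem_omegaCovers_iff.1 (hσ n)).2 F hF
      exact ⟨U, fun _ => hU⟩
    · exact ⟨∅, fun h => absurd h hF⟩
  choose U hU using this
  exact ⟨U, fun F n hF => ⟨(hσ n).1 _ (hU F n hF).1, (hU F n hF).2⟩,
    fun F hF => hw _ fun n => (hU (F n) n (hF n)).1⟩

end OmegaCovers

/-! ### The function space C_p(X) -/

namespace Cp

variable {X : Type*} [TopologicalSpace X]

theorem setOf_abs_sub_lt_mem_nhds (f : Cp X) (F : Finset X) {ε : ℝ} (hε : 0 < ε) :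
    {h : Cp X | ∀ x ∈ F, |h.1 x - f.1 x| < ε} ∈ 𝓝 f := by
  refine (Filter.eventually_all_finset F).2 fun x _ => ?_
  have hc : Continuous fun h : Cp X => |h.1 x - f.1 x| :=
    (((continuous_apply x).comp continuous_subtype_val).sub continuous_const).abs
  exact hc.continuousAt.eventually_lt continuousAt_const (by simpa using hε)

theorem mem_nhds_iff {f : Cp X} {S : Set (Cp X)} :
    S ∈ 𝓝 f ↔ ∃ (F : Finset X) (ε : ℝ), 0 < ε ∧ ∀ h : Cp X, (∀ x ∈ F, |h.1 x - f.1 x| < ε) →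
      h ∈ S := by
  refine ⟨fun hS => ?_, fun ⟨F, ε, hε, h⟩ =>
    mem_of_superset (setOf_abs_sub_lt_mem_nhds f F hε) h⟩
  obtain ⟨T, hT, hTS⟩ := (mem_nhds_induced Subtype.val f S).1 hS
  rw [nhds_pi, Filter.mem_pi'] at hT
  obtain ⟨F, t, ht, htT⟩ := hT
  choose ε hε hεt using fun x => Metric.mem_nhds_iff.1 (ht x)
  obtain ⟨δ, hδ, hδε⟩ : ∃ δ : ℝ, 0 < δ ∧ ∀ x ∈ F, δ ≤ ε x := by
    rcases F.eq_empty_or_nonempty with rfl | hF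
    · exact ⟨1, one_pos, by simp⟩
    · exact ⟨F.inf' hF ε, (Finset.lt_inf'_iff hF).2 fun x _ => hε x,
        fun x hx => Finset.inf'_le ε hx⟩
  exact ⟨F, δ, hδ, fun h hh => hTS (htT fun x hx => hεt x (by
    rw [Metric.mem_ball, Real.dist_eq]
    exact (hh x hx).trans_le (hδε x hx)))⟩

/-- In a Tychonoff space a continuous function can be prescribed on a finite set and be constant
outside a given neighbourhood of that set. -/
theorem exists_eqOn_eqOn_compl [T35Space X] (F : Finset X) {U : Set X} (hU : IsOpen U)
    (hF : ↑F ⊆ U) (g : X → ℝ) (c : ℝ) :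
    ∃ f : Cp X, (∀ x ∈ F, f.1 x = g x) ∧ ∀ x ∉ U, f.1 x = c := by
  classical
  have h (x : X) (hx : x ∈ F) : ∃ φ : X → ℝ, Continuous φ ∧ φ x = 1 ∧
      (∀ y ∈ F, y ≠ x → φ y = 0) ∧ ∀ y ∉ U, φ y = 0 := by
    obtain ⟨φ, hφ, h0, h1⟩ := CompletelyRegularSpace.completely_regular x
      (Uᶜ ∪ (F.erase x : Finset X)) (hU.isClosed_compl.union (Finset.isClosed _))
      (by simpa using hF hx)
    refine ⟨fun y => 1 - φ y, by fun_prop, by simp [h0], fun y hy hyx => ?_, fun y hy => ?_⟩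
    · have := h1 (Or.inr (by simp [hy, hyx]) : y ∈ Uᶜ ∪ ((F.erase x : Finset X) : Set X))
      simp [this]
    · have := h1 (Or.inl hy : y ∈ Uᶜ ∪ ((F.erase x : Finset X) : Set X))
      simp [this]
  choose φ hφ h1 h0 hc using h
  refine ⟨⟨fun y => c + ∑ x ∈ F.attach, (g x - c) * φ x x.2 y, by
    have := fun x : F => hφ x x.2
    fun_prop⟩, fun y hy => ?_, fun y hy => ?_⟩
  · have : ∑ x ∈ F.attach, (g x - c) * φ x x.2 y = g y - c := by
      rw [Finset.sum_eq_single ⟨y, hy⟩]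
      · simp [h1]
      · intro x _ hx
        rw [h0 x x.2 y hy fun e => hx (Subtype.ext e.symm), mul_zero]
      · simp
    simp only [this]
    ring
  · simp [hc _ _ y hy]

/-- The translation of `C_p(X)` that maps `f` to the zero function. -/
def subHomeomorph (f : Cp X) : Cp X ≃ₜ Cp X where
  toFun h := ⟨fun x => h.1 x - f.1 x, h.2.sub f.2⟩
  invFun h := ⟨fun x => h.1 x + f.1 x, h.2.add f.2⟩
  left_inv h := by ext; simp
  right_inv h := by ext; simp
  continuous_toFun := by
    refine Continuous.subtype_mk (continuous_pi fun x => ?_) _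
    exact ((continuous_apply x).comp continuous_subtype_val).sub continuous_const
  continuous_invFun := by
    refine Continuous.subtype_mk (continuous_pi fun x => ?_) _
    exact ((continuous_apply x).comp continuous_subtype_val).add continuous_const

theorem subHomeomorph_self (f : Cp X) : subHomeomorph f f = zeroFun X := by
  ext x
  exact sub_self _

theorem image_symm_mem_blades (f : Cp X) {A : Set (Cp X)} (hA : A ∈ blades (zeroFun X)) :
    (subHomeomorph f).symm '' A ∈ blades f := by
  change f ∈ closure _
  rw [← (subHomeomorph f).symm.image_closure]
  exact ⟨_, hA, by rw [← subHomeomorph_self f, Homeomorph.symm_apply_apply]⟩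

theorem strongCountableFanTightness_iff :
    StrongCountableFanTightness (Cp X) ↔
      StrongSelection (blades (zeroFun X)) (blades (zeroFun X)) := by
  refine ⟨fun h => h _, fun h f => h.of_equiv (subHomeomorph f).toEquiv (fun A hA => ?_)
    fun _ => image_symm_mem_blades f⟩
  change zeroFun X ∈ closure (subHomeomorph f '' A)
  rw [← (subHomeomorph f).image_closure, ← subHomeomorph_self f]
  exact mem_image_of_mem _ hA

theorem strongCountableDenseFanTightness_iff :
    StrongCountableDenseFanTightness (Cp X) ↔
      StrongSelection (denseSets (Cp X)) (blades (zeroFun X)) :=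
  ⟨fun h => h _, fun h f => h.of_equiv (subHomeomorph f).toEquiv
    (fun _ hA => (subHomeomorph f).surjective.denseRange.dense_image
      (subHomeomorph f).continuous hA) fun _ => image_symm_mem_blades f⟩

/-- If `X` is `Ω`-Rothberger, then I does not win the game of selecting points from sets with `0`
in their closure, not even if `0` only has to be no cluster point of the selected sequence. -/
theorem exists_play_mapClusterPt (hX : OmegaRothberger X) (R : List (Cp X) → Set (Cp X))
    (hR : ∀ s, R s ∈ blades (zeroFun X)) :
    ∃ b : ℕ → Cp X, (∀ n, b n ∈ R (OmegaGame.initial b n)) ∧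
      MapClusterPt (zeroFun X) atTop b := by
  -- The history length is the round number, so the tolerance tends to 0 along the play.
  obtain ⟨b, hb, hF⟩ := hX.exists_play R (fun s f => {x | |f.1 x| < 1 / ((s.length : ℝ) + 1)})
    (fun s f => isOpen_lt f.2.abs continuous_const) fun s F => by
      obtain ⟨f, hf, hfR⟩ := mem_closure_iff_nhds.1 (hR s) _
        (setOf_abs_sub_lt_mem_nhds (zeroFun X) F (Nat.one_div_pos_of_nat (n := s.length)))
      exact ⟨f, hfR, fun x hx => by simpa [zeroFun] using hf x hx⟩
  refine ⟨b, hb, mapClusterPt_iff_frequently.2 fun S hS => ?_⟩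
  obtain ⟨F, ε, hε, hS⟩ := mem_nhds_iff.1 hS
  obtain ⟨N, hN⟩ := exists_nat_one_div_lt hε
  refine ((hF F).and_eventually (eventually_ge_atTop N)).mono fun n ⟨hn, hNn⟩ => hS _ fun x hx => ?_
  have h1 : |(b n).1 x| < 1 / ((n : ℝ) + 1) := by simpa [OmegaGame.initial] using hn hx
  have h2 : (1 : ℝ) / (n + 1) ≤ 1 / (N + 1) := Nat.one_div_le_one_div hNn
  simpa [zeroFun] using h1.trans_le (h2.trans hN.le)

theorem not_omegaRothberger_of_iWins_blades
    (h : (strongSelectionGame (blades (zeroFun X)) (blades (zeroFun X))).IWins) :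
    ¬ OmegaRothberger X := by
  intro hX
  obtain ⟨σ, hσ, hw⟩ := h
  obtain ⟨b, hb, hc⟩ := exists_play_mapClusterPt hX σ hσ
  exact hw b hb (mem_closure_iff_nhds.2 fun S hS => by
    obtain ⟨n, hn⟩ := (mapClusterPt_iff_frequently.1 hc S hS).exists
    exact ⟨b n, hn, n, rfl⟩)

theorem not_omegaRothberger_of_iiWins_clusteringGame
    (h : (clusteringGame (zeroFun X)).IIWins) : ¬ OmegaRothberger X := by
  intro hX
  obtain ⟨τ, hτ, hw⟩ := h
  obtain ⟨ρ, hρ, hrec⟩ := OmegaGame.exists_recover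
    (fun U => IsOpen U ∧ zeroFun X ∈ U) τ
  obtain ⟨b, hb, hc⟩ := exists_play_mapClusterPt hX
    (fun h => {f | ∃ U, (IsOpen U ∧ zeroFun X ∈ U) ∧ τ (ρ h ++ [U]) = f}) fun h =>
      mem_closure_iff.2 fun U hU h0 =>
        ⟨_, hτ _ U (hρ h) ⟨hU, h0⟩, U, ⟨hU, h0⟩, rfl⟩
  obtain ⟨U, hU, e⟩ := hrec b hb
  have := hw U hU
  simp only [e] at this
  exact this hc

theorem iPredeterminedWins_denseSets [T35Space X]
    (h : (strongSelectionGame (omegaCovers X) (omegaCovers X)).IPredeterminedWins) :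
    (strongSelectionGame (denseSets (Cp X)) (blades (zeroFun X))).IPredeterminedWins := by
  obtain ⟨σ, hσ, hw⟩ := h
  -- If 0 is in the closure of the selection, then for each finite set some selected function is
  -- below 1 there, which puts the set inside the corresponding `U`.
  refine ⟨fun n => {f | ∃ U ∈ σ n, ∀ x ∉ U, f.1 x = 1}, fun n g => ?_, fun f hf h0 => ?_⟩
  · refine mem_closure_iff_nhds.2 fun S hS => ?_
    obtain ⟨F, ε, hε, hS⟩ := mem_nhds_iff.1 hS
    obtain ⟨U, hU, hFU⟩ := (mem_omegaCovers_iff.1 (hσ n)).2 F F.finite_toSet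
    obtain ⟨f, hfF, hfU⟩ := exists_eqOn_eqOn_compl F ((hσ n).1 U hU) hFU g.1 1
    exact ⟨f, hS f fun x hx => by simpa [hfF x hx] using hε, U, hU, hfU⟩
  · choose U hU hfU using hf
    refine hw U hU (mem_omegaCovers_iff.2 ⟨?_, fun F hF => ?_⟩)
    · rintro _ ⟨n, rfl⟩
      exact (hσ n).1 _ (hU n)
    · obtain ⟨_, hn, n, rfl⟩ := mem_closure_iff_nhds.1 h0 _
        (setOf_abs_sub_lt_mem_nhds (zeroFun X) hF.toFinset one_pos)
      refine ⟨_, ⟨n, rfl⟩, fun x hx => ?_⟩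
      by_contra hxU
      have := hn x (by simpa using hx)
      simp [hfU n x hxU, zeroFun] at this

/-- If II wins the finite-open game by a Markov strategy, then II can make functions converge to
infinity on some finite set, by a Markov strategy. -/
theorem iiMarkovWins_discreteSelectionGame [T35Space X]
    (h : (omegaFiniteOpenGame X).IIMarkovWins) : (discreteSelectionGame (Cp X)).IIMarkovWins := by
  obtain ⟨σ, hσ, hw⟩ := h
  have (W : Set (Cp X)) (n : ℕ) : ∃ (f : Cp X) (F : Finset X), IsOpen W ∧ W.Nonempty →
      f ∈ W ∧ ∀ x ∉ σ F n, f.1 x = n := by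
    by_cases hW : IsOpen W ∧ W.Nonempty
    · obtain ⟨g, hg⟩ := hW.2
      obtain ⟨F, ε, hε, hF⟩ := mem_nhds_iff.1 (hW.1.mem_nhds hg)
      obtain ⟨hU, hFU⟩ := hσ F n F.finite_toSet
      obtain ⟨f, hfF, hfU⟩ := exists_eqOn_eqOn_compl F hU hFU g.1 n
      exact ⟨f, F, fun _ => ⟨hF f fun x hx => by simpa [hfF x hx] using hε, hfU⟩⟩
    · exact ⟨zeroFun X, ∅, fun h => absurd h hW⟩
  choose τ F hτ using this
  refine ⟨τ, fun W n hW => (hτ W n hW).1, fun W hW => not_not.2 ?_⟩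
  have hcov := hw (fun n => F (W n) n) fun n => (F (W n) n).finite_toSet
  -- A finite set contained in none of II's open sets meets each complement, where the n-th function
  -- is n.
  obtain ⟨G, hG⟩ : ∃ G : Finset X, ∀ n, ∃ x ∈ G, (τ (W n) n).1 x = n := by
    by_contra! hG
    refine hcov (mem_omegaCovers_iff.2 ⟨?_, fun G hGf => ?_⟩)
    · rintro _ ⟨n, rfl⟩
      exact (hσ _ n (F (W n) n).finite_toSet).1
    · obtain ⟨n, hn⟩ := hG hGf.toFinset
      refine ⟨_, ⟨n, rfl⟩, fun x hx => ?_⟩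
      by_contra hxU
      exact hn x (by simpa using hx) ((hτ (W n) n (hW n)).2 x hxU)
  refine isClosed_and_discrete_iff.2 fun k => ?_
  have hfin : (range (fun n => τ (W n) n) ∩
      {h : Cp X | ∀ x ∈ G, |h.1 x - k.1 x| < 1}).Finite := by
    -- Functions within 1 of `k` on `G` stay below `N` there, so only rounds before `N` contribute.
    obtain ⟨N, hN⟩ := exists_nat_gt (∑ x ∈ G, |k.1 x| + 1)
    refine ((finite_Iio N).image fun n => τ (W n) n).subset ?_
    rintro _ ⟨⟨n, rfl⟩, hn⟩
    refine ⟨n, ?_, rfl⟩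
    obtain ⟨x, hx, e⟩ := hG n
    have h1 : |(n : ℝ) - k.1 x| < 1 := by
      rw [← e]
      exact hn x hx
    have h2 : |k.1 x| ≤ ∑ x ∈ G, |k.1 x| :=
      Finset.single_le_sum (f := fun x => |k.1 x|) (fun _ _ => abs_nonneg _) hx
    have h3 := (abs_lt.1 h1).2
    have h4 := le_abs_self (k.1 x)
    have : (n : ℝ) < N := by linarith
    exact_mod_cast this
  rw [Filter.disjoint_principal_right]
  have h1 : {h : Cp X | ∀ x ∈ G, |h.1 x - k.1 x| < 1} ∈ 𝓝[≠] k :=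
    mem_nhdsWithin_of_mem_nhds (setOf_abs_sub_lt_mem_nhds k G one_pos)
  have h2 : ((range (fun n => τ (W n) n) ∩
      {h : Cp X | ∀ x ∈ G, |h.1 x - k.1 x| < 1}) \ {k})ᶜ ∈ 𝓝[≠] k :=
    mem_nhdsWithin_of_mem_nhds (hfin.sdiff.isClosed.isOpen_compl.mem_nhds fun h => h.2 rfl)
  filter_upwards [h1, h2, self_mem_nhdsWithin] with h h1 h2 h3 h4
  exact h2 ⟨⟨h4, h1⟩, h3⟩

theorem not_isOpen_singleton [Nonempty X] (f : Cp X) : ¬ IsOpen {f} := by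
  intro h
  obtain ⟨F, ε, hε, hF⟩ := mem_nhds_iff.1 (h.mem_nhds rfl)
  have e := hF ⟨fun x => f.1 x + ε / 2, f.2.add continuous_const⟩ fun x _ => by
    simp only [add_sub_cancel_left]
    rw [abs_of_pos (half_pos hε)]
    exact half_lt_self hε
  have := congrArg (fun g : Cp X => g.1 (Classical.arbitrary X)) (mem_singleton_iff.1 e)
  simp only [add_eq_left] at this
  linarith

end Cp

/-! ### Point-picking games on a general space -/

section Games

variable {Y : Type*} [TopologicalSpace Y] {y : Y}

theorem iiMarkovWins_clusteringGame
    (h : (strongSelectionGame (blades y) (blades y)).IPredeterminedWins) :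
    (clusteringGame y).IIMarkovWins := by
  obtain ⟨σ, hσ, hw⟩ := h
  have (U : Set Y) (n : ℕ) : ∃ z, IsOpen U ∧ y ∈ U → z ∈ U ∩ σ n := by
    by_cases hU : IsOpen U ∧ y ∈ U
    · obtain ⟨z, hz⟩ := mem_closure_iff.1 (hσ n) U hU.1 hU.2
      exact ⟨z, fun _ => hz⟩
    · exact ⟨y, fun h => absurd h hU⟩
  choose τ hτ using this
  refine ⟨τ, fun U n hU => (hτ U n hU).1, fun U hU hc => ?_⟩
  refine hw _ (fun n => (hτ (U n) n (hU n)).2) (mem_closure_iff_nhds.2 fun S hS => ?_)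
  obtain ⟨n, hn⟩ := (mapClusterPt_iff_frequently.1 hc S hS).exists
  exact ⟨_, hn, n, rfl⟩

theorem iiMarkovWins_closureGame
    (h : (strongSelectionGame (denseSets Y) (blades y)).IPredeterminedWins) :
    (closureGame y).IIMarkovWins := by
  obtain ⟨σ, hσ, hw⟩ := h
  have (U : Set Y) (n : ℕ) : ∃ z, IsOpen U ∧ U.Nonempty → z ∈ U ∩ σ n := by
    by_cases hU : IsOpen U ∧ U.Nonempty
    · obtain ⟨z, hz⟩ := (hσ n).inter_open_nonempty U hU.1 hU.2
      exact ⟨z, fun _ => hz⟩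
    · exact ⟨y, fun h => absurd h hU⟩
  choose τ hτ using this
  exact ⟨τ, fun U n hU => (hτ U n hU).1, fun U hU =>
    hw _ fun n => (hτ (U n) n (hU n)).2⟩

theorem iWins_denseSets_of_iiWins_closureGame (h : (closureGame y).IIWins) :
    (strongSelectionGame (denseSets Y) (blades y)).IWins := by
  obtain ⟨τ, hτ, hw⟩ := h
  obtain ⟨ρ, hρ, hrec⟩ := OmegaGame.exists_recover (fun U => IsOpen U ∧ U.Nonempty) τ
  refine ⟨fun h => {z | ∃ U, (IsOpen U ∧ U.Nonempty) ∧ τ (ρ h ++ [U]) = z}, fun h => ?_,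
    fun b hb => ?_⟩
  · exact dense_iff_inter_open.2 fun U hU hne =>
      ⟨_, hτ _ U (hρ h) ⟨hU, hne⟩, U, ⟨hU, hne⟩, rfl⟩
  · obtain ⟨U, hU, e⟩ := hrec b hb
    have := hw U hU
    simp only [e] at this
    exact this

/-- II removes `y` from each of I's sets, which leaves them non-empty since `y` is not isolated. The
answers form a closed set missing `y`. -/
theorem iiWins_closureGame_of_discreteSelectionGame [T1Space Y] (hy : ¬ IsOpen {y})
    (h : (discreteSelectionGame Y).IIWins) : (closureGame y).IIWins := by
  obtain ⟨τ, hτ, hw⟩ := h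
  have hdiff (U : Set Y) (hU : IsOpen U ∧ U.Nonempty) : IsOpen (U \ {y}) ∧ (U \ {y}).Nonempty := by
    refine ⟨hU.1.sdiff isClosed_singleton, ?_⟩
    rw [nonempty_iff_ne_empty]
    intro he
    rcases subset_singleton_iff_eq.1 (sdiff_eq_empty.1 he) with e | e
    · exact hU.2.ne_empty e
    · exact hy (e ▸ hU.1)
  have hlegal (s : List (Set Y)) (U : Set Y) (hs : ∀ c ∈ s, IsOpen c ∧ c.Nonempty)
      (hU : IsOpen U ∧ U.Nonempty) : τ ((s ++ [U]).map (· \ {y})) ∈ U \ {y} := by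
    rw [List.map_append]
    refine hτ _ _ (fun c hc => ?_) (hdiff U hU)
    obtain ⟨d, hd, rfl⟩ := List.mem_map.1 hc
    exact hdiff d (hs d hd)
  refine ⟨fun s => τ (s.map (· \ {y})), fun s U hs hU => (hlegal s U hs hU).1, fun U hU hc => ?_⟩
  have hcd := not_not.1 (hw (fun n => U n \ {y}) fun n => hdiff _ (hU n))
  have e (n : ℕ) : (OmegaGame.initial U n).map (· \ {y}) =
      OmegaGame.initial (fun n => U n \ {y}) n := by
    simp [OmegaGame.initial]
  simp only [e] at hc
  change y ∈ closure _ at hc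
  rw [hcd.1.closure_eq] at hc
  obtain ⟨n, hn⟩ := hc
  refine (hlegal (OmegaGame.initial U n) (U n) (fun c hc => ?_) (hU n)).2 ?_
  · obtain ⟨k, _, rfl⟩ := List.mem_map.1 hc
    exact hU k
  · rw [← OmegaGame.initial_succ, e]
    exact hn

end Games

/-! ### The equivalences -/

theorem theorem22 (X : Type*) [TopologicalSpace X] [T35Space X] [Nonempty X] :
    List.TFAE [
      -- (a), (b)
      (omegaFiniteOpenGame X).IIWins,
      (omegaFiniteOpenGame X).IIMarkovWins,
      -- (c), (d) in both forms
      (strongSelectionGame (omegaCovers X) (omegaCovers X)).IWins,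
      ¬ OmegaRothberger X,
      (strongSelectionGame (omegaCovers X) (omegaCovers X)).IPredeterminedWins,
      -- (e), (f) in both forms
      (strongSelectionGame (blades (Cp.zeroFun X)) (blades (Cp.zeroFun X))).IWins,
      ¬ StrongCountableFanTightness (Cp X),
      (strongSelectionGame (blades (Cp.zeroFun X)) (blades (Cp.zeroFun X))).IPredeterminedWins,
      -- (g), (h) in both forms
      (strongSelectionGame (denseSets (Cp X)) (blades (Cp.zeroFun X))).IWins,
      ¬ StrongCountableDenseFanTightness (Cp X),
      (strongSelectionGame (denseSets (Cp X)) (blades (Cp.zeroFun X))).IPredeterminedWins,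
      -- (i), (j)
      (clusteringGame (Cp.zeroFun X)).IIWins,
      (clusteringGame (Cp.zeroFun X)).IIMarkovWins,
      -- (k), (l)
      (closureGame (Cp.zeroFun X)).IIWins,
      (closureGame (Cp.zeroFun X)).IIMarkovWins,
      -- (m), (n)
      (discreteSelectionGame (Cp X)).IIWins,
      (discreteSelectionGame (Cp X)).IIMarkovWins] := by
  have : Nonempty (Cp X) := ⟨Cp.zeroFun X⟩
  tfae_have 2 → 1 := OmegaGame.IIMarkovWins.iiWins
  tfae_have 1 → 3 := iWins_omegaCovers_of_iiWins
  tfae_have 3 → 4 := not_omegaRothberger_of_iWins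
  tfae_have 4 ↔ 5 := not_strongSelection_iff
  tfae_have 5 → 2 := iiMarkovWins_of_iPredeterminedWins_omegaCovers
  tfae_have 5 → 11 := Cp.iPredeterminedWins_denseSets
  tfae_have 10 ↔ 11 :=
    (not_congr Cp.strongCountableDenseFanTightness_iff).trans not_strongSelection_iff
  tfae_have 7 ↔ 8 := (not_congr Cp.strongCountableFanTightness_iff).trans not_strongSelection_iff
  tfae_have 11 → 8 := fun h => not_strongSelection_iff.1 fun hs =>
    not_strongSelection_iff.2 h (hs.mono (denseSets_subset_blades _))
  tfae_have 8 → 6 := OmegaGame.IPredeterminedWins.iWins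
  tfae_have 6 → 4 := Cp.not_omegaRothberger_of_iWins_blades
  tfae_have 11 → 9 := OmegaGame.IPredeterminedWins.iWins
  tfae_have 9 → 6 := iWins_strongSelectionGame_mono (denseSets_subset_blades _)
  tfae_have 11 → 15 := iiMarkovWins_closureGame
  tfae_have 15 → 14 := OmegaGame.IIMarkovWins.iiWins
  tfae_have 14 → 9 := iWins_denseSets_of_iiWins_closureGame
  tfae_have 8 → 13 := iiMarkovWins_clusteringGame
  tfae_have 13 → 12 := OmegaGame.IIMarkovWins.iiWins
  tfae_have 12 → 4 := Cp.not_omegaRothberger_of_iiWins_clusteringGame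
  have : Nonempty (Cp X) := ⟨Cp.zeroFun X⟩
  tfae_have 2 → 17 := Cp.iiMarkovWins_discreteSelectionGame
  tfae_have 17 → 16 := OmegaGame.IIMarkovWins.iiWins
  tfae_have 16 → 14 :=
    iiWins_closureGame_of_discreteSelectionGame (Cp.not_isOpen_singleton (Cp.zeroFun X))
  tfae_finish
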